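/- \textbf{Setting.} A \emph{basic action theory} (BAT) $\mathcal D$ over finitely many objects is a theory in the many-sorted situation calculus with sorts object, action, situation and time, over a finite signature of object constants, action types, fluents (relational, or functional with values of sort object or time) and rigid relation and function symbols; apart from the situation argument of the fluents, all arguments of these symbols, including those of the action types, are of sort object. Terms of sort time are built from time variables, rational constants, fluents and rigid functions of sort time, $+$, $-$ and $\times$, and are interpreted in the real numbers with their standard operations and order. $\mathcal D$ consists of \begin{itemize} \item a finite set of sentences uniform in the initial situation $S_0$, with complete information: for every closed atomic formula $\phi$ uniform in $S_0$, $\mathcal D\models\phi$ or $\mathcal D\models\neg\phi$ (here the sort time is all of $\mathbb R$); \item one precondition axiom $\mathrm{Poss}(A(\vec o),s)\equiv\phi_A(\vec o,s)$ for each action type $A$; \item one successor state axiom for each fluent, $F(\vec o,do(a,s))\equiv\phi_F(\vec o,a,s)$ for relational and $f(\vec o,do(a,s))=y\equiv\phi_f(\vec o,y,a,s)$ for functional fluents, where all $\phi_A,\phi_F,\phi_f$ are first-order formulas uniform in $s$; \item domain closure and unique names axioms for actions and for objects, and the foundational axioms of the situation calculus (injectivity of $do$, second-order induction over situations, and the axioms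 of the ordering $\sqsubset$ of situations). \end{itemize} $\mathcal D$ is \emph{real-valued} if its signature contains a fluent of sort time. A situation $s$ is executable, $\mathrm{exec}(s)$, if $\mathrm{Poss}(a,s')$ holds whenever $do(a,s')\sqsubseteq s$. For a real number $b$, consider the following two ways to bound the values of sort time by $b$: \begin{enumerate} \item[(i)] the sort time is $\mathbb R$, and every fluent of sort time satisfies $f(\vec o,s)\le b$ for all objects $\vec o$ and all situations $s$; \item[(ii)] the sort time itself is restricted by $\forall t.\,t\le b$: it is $\{t\in\mathbb R : t\le b\}$, so that the time variables range over this set and all fluents and rigid functions of sort time take values in it, while arithmetical terms are evaluated in $\mathbb R$. \end{enumerate} The \emph{time-bounded reachability problem} for the bound $b$, under (i) or under (ii), asks, given $\mathcal D$ and a situation-suppressed sentence $\phi$, whether $\exists s.\ \mathrm{exec}(s)\wedge\phi[s]$ holds in every model of $\mathcal D$ that satisfies the bound. \textbf{Theorem.} For every real number $b\ge 2$, and under each of the two readings (i) and (ii) of the bound, the time-bounded reachability problem for real-valued BATs is undecidable. More precisely, there is no computable function that, given the code of a real-valued BAT $\mathcal D$ and of a sentence $\phi$, gives the correct answer for all $\mathcal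 D$ which have complete information and at least one model satisfying the bound (whatever it does on other inputs). -/

import Mathlib

/-!
# Basic action theories over finitely many objects, with fluents of sort time

A many-sorted situation calculus with the sorts object, action, situation and time.
Formulas are situation-suppressed: they are exactly the formulas uniform in one situation term,
and they are evaluated at a situation.
-/

namespace SitCalc

/-- A finite signature.  Each list declares one symbol per entry, and the entry is the number of
object arguments of the symbol (for fluents: not counting the situation argument). -/
structure Signature where
  /-- number of object constants -/
  objects : ℕ
  /-- action types -/
  actions : List ℕ
  /-- relational fluents -/
  relFluents : List ℕ
  /-- functional fluents of sort object -/
  objFluents : List ℕ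
  /-- functional fluents of sort time -/
  timeFluents : List ℕ
  /-- rigid relations -/
  rigidRels : List ℕ
  /-- rigid functions of sort object -/
  rigidObjFuns : List ℕ
  /-- rigid functions of sort time -/
  rigidTimeFuns : List ℕ

/-- Situation-suppressed terms of sort object, with `n` object variables. -/
inductive ObjTerm (S : Signature) (n : ℕ) : Type
  | var (x : Fin n) : ObjTerm S n
  | const (c : Fin S.objects) : ObjTerm S n
  | fluent (i : Fin S.objFluents.length) (args : Fin (S.objFluents.get i) → ObjTerm S n) :
      ObjTerm S n
  | rigid (i : Fin S.rigidObjFuns.length) (args : Fin (S.rigidObjFuns.get i) → ObjTerm S n) :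
      ObjTerm S n

/-- Situation-suppressed terms of sort action, with `n` object and `m` action variables. -/
inductive ActTerm (S : Signature) (n m : ℕ) : Type
  | var (x : Fin m) : ActTerm S n m
  | app (i : Fin S.actions.length) (args : Fin (S.actions.get i) → ObjTerm S n) : ActTerm S n m

/-- Situation-suppressed terms of sort time, with `n` object and `k` time variables. -/
inductive TimeTerm (S : Signature) (n k : ℕ) : Type
  | var (x : Fin k) : TimeTerm S n k
  | num (q : ℚ) : TimeTerm S n k
  | fluent (i : Fin S.timeFluents.length) (args : Fin (S.timeFluents.get i) → ObjTerm S n) :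
      TimeTerm S n k
  | rigid (i : Fin S.rigidTimeFuns.length) (args : Fin (S.rigidTimeFuns.get i) → ObjTerm S n) :
      TimeTerm S n k
  | add (t u : TimeTerm S n k) : TimeTerm S n k
  | sub (t u : TimeTerm S n k) : TimeTerm S n k
  | mul (t u : TimeTerm S n k) : TimeTerm S n k

/-- Situation-suppressed formulas with `n` object, `m` action and `k` time variables.
The other connectives and the existential quantifiers are the usual classical abbreviations.
A quantifier binds the variable with index `0` of its sort and shifts the others by one. -/
inductive Formula (S : Signature) : ℕ → ℕ → ℕ → Type
  | rel {n m k : ℕ} (i : Fin S.relFluents.length)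
      (args : Fin (S.relFluents.get i) → ObjTerm S n) : Formula S n m k
  | rigidRel {n m k : ℕ} (i : Fin S.rigidRels.length)
      (args : Fin (S.rigidRels.get i) → ObjTerm S n) : Formula S n m k
  | eqObj {n m k : ℕ} (t u : ObjTerm S n) : Formula S n m k
  | eqAct {n m k : ℕ} (t u : ActTerm S n m) : Formula S n m k
  | eqTime {n m k : ℕ} (t u : TimeTerm S n k) : Formula S n m k
  | ltTime {n m k : ℕ} (t u : TimeTerm S n k) : Formula S n m k
  | neg {n m k : ℕ} (p : Formula S n m k) : Formula S n m k
  | and {n m k : ℕ} (p q : Formula S n m k) : Formula S n m k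
  | allObj {n m k : ℕ} (p : Formula S (n + 1) m k) : Formula S n m k
  | allAct {n m k : ℕ} (p : Formula S n (m + 1) k) : Formula S n m k
  | allTime {n m k : ℕ} (p : Formula S n m (k + 1)) : Formula S n m k

/-- A situation-suppressed formula without free variables. -/
abbrev Sentence (S : Signature) := Formula S 0 0 0

/-- Atomic formulas, built from fluents, rigid symbols, equality and `<`. -/
def Formula.IsAtomic {S : Signature} {n m k : ℕ} : Formula S n m k → Prop
  | .rel _ _ => True
  | .rigidRel _ _ => True
  | .eqObj _ _ => True
  | .eqAct _ _ => True
  | .eqTime _ _ => True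
  | .ltTime _ _ => True
  | .neg _ => False
  | .and _ _ => False
  | .allObj _ => False
  | .allAct _ => False
  | .allTime _ => False

/-- The domain-specific axioms of a basic action theory with finitely many axioms.
* `init`: the sentences that describe the initial situation;
* `poss`: for each action type `A`, the right-hand side of `Poss(A(o), s) ≡ φ(o, s)`;
* `ssaRel`: for each relational fluent `F`, the right-hand side of `F(o, do(a, s)) ≡ φ(o, a, s)`;
* `ssaObj`: for each functional fluent `f` of sort object, the right-hand side of
  `f(o, do(a, s)) = y ≡ φ(o, y, a, s)`, where `y` is the object variable `0` and the arguments `o`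
  are the object variables `1, 2, …`;
* `ssaTime`: the same for each functional fluent of sort time, where `y` is the time variable.
The action variable is `a`.  The axioms on actions and objects and the foundational axioms are the
same for all theories over a signature, see `Interpretation.Models`. -/
structure BAT (S : Signature) where
  init : List (Sentence S)
  poss : ∀ i : Fin S.actions.length, Formula S (S.actions.get i) 0 0
  ssaRel : ∀ i : Fin S.relFluents.length, Formula S (S.relFluents.get i) 1 0
  ssaObj : ∀ i : Fin S.objFluents.length, Formula S (S.objFluents.get i + 1) 1 0
  ssaTime : ∀ i : Fin S.timeFluents.length, Formula S (S.timeFluents.get i) 1 1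

/-! ### Semantics -/

/-- A many-sorted structure.  Terms of sort time are evaluated in the real numbers with the
standard arithmetic.  The variables of sort time range over `timeDom`, which also contains the
values of all fluents and rigid functions of sort time; the standard choice is `Set.univ`. -/
structure Interpretation (S : Signature) where
  Obj : Type
  Act : Type
  Sit : Type
  timeDom : Set ℝ
  obj_nonempty : Nonempty Obj
  act_nonempty : Nonempty Act
  const : Fin S.objects → Obj
  act : ∀ i : Fin S.actions.length, (Fin (S.actions.get i) → Obj) → Act
  /-- the initial situation -/
  s₀ : Sit
  /-- the situation that results from doing an action in a situation -/
  doAct : Act → Sit → Sit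
  /-- the ordering of situations -/
  prec : Sit → Sit → Prop
  Poss : Act → Sit → Prop
  rel : ∀ i : Fin S.relFluents.length, (Fin (S.relFluents.get i) → Obj) → Sit → Prop
  objFluent : ∀ i : Fin S.objFluents.length, (Fin (S.objFluents.get i) → Obj) → Sit → Obj
  timeFluent : ∀ i : Fin S.timeFluents.length, (Fin (S.timeFluents.get i) → Obj) → Sit → ℝ
  rigidRel : ∀ i : Fin S.rigidRels.length, (Fin (S.rigidRels.get i) → Obj) → Prop
  rigidObjFun : ∀ i : Fin S.rigidObjFuns.length, (Fin (S.rigidObjFuns.get i) → Obj) → Obj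
  rigidTimeFun : ∀ i : Fin S.rigidTimeFuns.length, (Fin (S.rigidTimeFuns.get i) → Obj) → ℝ
  timeFluent_mem : ∀ i o s, timeFluent i o s ∈ timeDom
  rigidTimeFun_mem : ∀ i o, rigidTimeFun i o ∈ timeDom

variable {S : Signature}

/-- The value of an object term in the situation `s`. -/
def ObjTerm.eval (M : Interpretation S) (s : M.Sit) {n : ℕ} (o : Fin n → M.Obj) :
    ObjTerm S n → M.Obj
  | .var x => o x
  | .const c => M.const c
  | .fluent i args => M.objFluent i (fun j => (args j).eval M s o) s
  | .rigid i args => M.rigidObjFun i (fun j => (args j).eval M s o)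

/-- The value of an action term in the situation `s`. -/
def ActTerm.eval (M : Interpretation S) (s : M.Sit) {n m : ℕ} (o : Fin n → M.Obj)
    (a : Fin m → M.Act) : ActTerm S n m → M.Act
  | .var x => a x
  | .app i args => M.act i (fun j => (args j).eval M s o)

/-- The value of a time term in the situation `s`. -/
def TimeTerm.eval (M : Interpretation S) (s : M.Sit) {n k : ℕ} (o : Fin n → M.Obj)
    (t : Fin k → ℝ) : TimeTerm S n k → ℝ
  | .var x => t x
  | .num q => (q : ℝ)
  | .fluent i args => M.timeFluent i (fun j => (args j).eval M s o) s
  | .rigid i args => M.rigidTimeFun i (fun j => (args j).eval M s o)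
  | .add u v => u.eval M s o t + v.eval M s o t
  | .sub u v => u.eval M s o t - v.eval M s o t
  | .mul u v => u.eval M s o t * v.eval M s o t

/-- Truth of `φ[s]` under an assignment of the object, action and time variables. -/
def Formula.Holds (M : Interpretation S) (s : M.Sit) : {n m k : ℕ} → Formula S n m k →
    (Fin n → M.Obj) → (Fin m → M.Act) → (Fin k → ℝ) → Prop
  | _, _, _, .rel i args, o, _, _ => M.rel i (fun j => (args j).eval M s o) s
  | _, _, _, .rigidRel i args, o, _, _ => M.rigidRel i (fun j => (args j).eval M s o)
  | _, _, _, .eqObj u v, o, _, _ => u.eval M s o = v.eval M s o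
  | _, _, _, .eqAct u v, o, a, _ => u.eval M s o a = v.eval M s o a
  | _, _, _, .eqTime u v, o, _, t => u.eval M s o t = v.eval M s o t
  | _, _, _, .ltTime u v, o, _, t => u.eval M s o t < v.eval M s o t
  | _, _, _, .neg p, o, a, t => ¬ p.Holds M s o a t
  | _, _, _, .and p q, o, a, t => p.Holds M s o a t ∧ q.Holds M s o a t
  | n, _, _, .allObj p, o, a, t =>
      ∀ x : M.Obj, p.Holds M s (Fin.cons x o : Fin (n + 1) → M.Obj) a t
  | _, m, _, .allAct p, o, a, t =>
      ∀ x : M.Act, p.Holds M s o (Fin.cons x a : Fin (m + 1) → M.Act) t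
  | _, _, k, .allTime p, o, a, t =>
      ∀ x ∈ M.timeDom, p.Holds M s o a (Fin.cons x t : Fin (k + 1) → ℝ)

/-- Truth of `φ[s]` for a sentence `φ`. -/
def Sentence.Satisfied (M : Interpretation S) (s : M.Sit) (φ : Sentence S) : Prop :=
  φ.Holds M s Fin.elim0 Fin.elim0 Fin.elim0

/-- The foundational axioms of the situation calculus; the second one is second-order induction. -/
structure Interpretation.Foundational (M : Interpretation S) : Prop where
  do_inj : ∀ a₁ a₂ s₁ s₂, M.doAct a₁ s₁ = M.doAct a₂ s₂ → a₁ = a₂ ∧ s₁ = s₂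
  induction : ∀ P : M.Sit → Prop, P M.s₀ → (∀ a s, P s → P (M.doAct a s)) → ∀ s, P s
  not_prec_s₀ : ∀ s, ¬ M.prec s M.s₀
  prec_do : ∀ a s s', M.prec s (M.doAct a s') ↔ (M.prec s s' ∨ s = s')

/-- `M` satisfies all axioms of the theory. -/
structure Interpretation.Models (M : Interpretation S) (D : BAT S) : Prop where
  init : ∀ φ ∈ D.init, Sentence.Satisfied M M.s₀ φ
  poss : ∀ i (o : Fin (S.actions.get i) → M.Obj) s,
    M.Poss (M.act i o) s ↔ (D.poss i).Holds M s o Fin.elim0 Fin.elim0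
  ssaRel : ∀ i (o : Fin (S.relFluents.get i) → M.Obj) a s,
    M.rel i o (M.doAct a s) ↔ (D.ssaRel i).Holds M s o (fun _ => a) Fin.elim0
  ssaObj : ∀ i (o : Fin (S.objFluents.get i) → M.Obj) y a s,
    M.objFluent i o (M.doAct a s) = y ↔
      (D.ssaObj i).Holds M s (Fin.cons y o : Fin (S.objFluents.get i + 1) → M.Obj)
        (fun _ => a) Fin.elim0
  ssaTime : ∀ i (o : Fin (S.timeFluents.get i) → M.Obj), ∀ y ∈ M.timeDom, ∀ a s,
    M.timeFluent i o (M.doAct a s) = y ↔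
      (D.ssaTime i).Holds M s o (fun _ => a) (fun _ => y)
  /-- unique names for actions -/
  act_unique : Function.Injective
    (fun p : (Σ i : Fin S.actions.length, Fin (S.actions.get i) → M.Obj) => M.act p.1 p.2)
  /-- domain closure for actions -/
  act_closure : ∀ a, ∃ i o, a = M.act i o
  /-- unique names for objects -/
  obj_unique : Function.Injective M.const
  /-- domain closure for objects -/
  obj_closure : ∀ x, ∃ c, x = M.const c
  foundational : M.Foundational

/-- `exec(s)`: every action performed in reaching `s` was possible when it was performed. -/
def Interpretation.Exec (M : Interpretation S) (s : M.Sit) : Prop :=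
  ∀ a s', (M.prec (M.doAct a s') s ∨ M.doAct a s' = s) → M.Poss a s'

/-- The sort time is all of `ℝ`. -/
def Interpretation.Standard (M : Interpretation S) : Prop :=
  M.timeDom = Set.univ

/-- The sort time is all of `ℝ` and all fluents of sort time are bounded above by `b`, in all
situations. -/
def Interpretation.FluentsBounded (b : ℝ) (M : Interpretation S) : Prop :=
  M.Standard ∧ ∀ i o s, M.timeFluent i o s ≤ b

/-- The sort time satisfies `∀ t. t ≤ b`: it consists of exactly the real numbers up to `b`. -/
def Interpretation.SortBounded (b : ℝ) (M : Interpretation S) : Prop :=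
  M.timeDom = Set.Iic b

/-- Complete information about the initial situation: every closed atomic formula, evaluated
initially, is entailed or refuted by the theory. -/
def BAT.CompleteInformation (D : BAT S) : Prop :=
  ∀ φ : Sentence S, φ.IsAtomic →
    (∀ M : Interpretation S, M.Standard → M.Models D → Sentence.Satisfied M M.s₀ φ) ∨
    (∀ M : Interpretation S, M.Standard → M.Models D → ¬ Sentence.Satisfied M M.s₀ φ)

/-- The theory, together with the condition `K` on the sort time, has a model. -/
def BAT.Consistent (K : Interpretation S → Prop) (D : BAT S) : Prop :=
  ∃ M : Interpretation S, K M ∧ M.Models D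

/-- The theory, together with the condition `K` on the sort time, entails
`∃ s. exec(s) ∧ φ[s]`. -/
def BAT.EntailsReachable (K : Interpretation S → Prop) (D : BAT S) (φ : Sentence S) : Prop :=
  ∀ M : Interpretation S, K M → M.Models D → ∃ s, M.Exec s ∧ Sentence.Satisfied M s φ

/-! ### Codes

An injective effective encoding of the inputs by natural numbers. -/

/-- The code of an object term. -/
def ObjTerm.code {n : ℕ} : ObjTerm S n → ℕ
  | .var x => Nat.pair 0 x
  | .const c => Nat.pair 1 c
  | .fluent i args => Nat.pair 2 (Nat.pair i (Encodable.encode (List.ofFn fun j => (args j).code)))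
  | .rigid i args => Nat.pair 3 (Nat.pair i (Encodable.encode (List.ofFn fun j => (args j).code)))

/-- The code of a tuple of object terms. -/
def argsCode {n r : ℕ} (args : Fin r → ObjTerm S n) : ℕ :=
  Encodable.encode (List.ofFn fun j => (args j).code)

/-- The code of an action term. -/
def ActTerm.code {n m : ℕ} : ActTerm S n m → ℕ
  | .var x => Nat.pair 0 x
  | .app i args => Nat.pair 1 (Nat.pair i (argsCode args))

/-- The code of a time term. -/
def TimeTerm.code {n k : ℕ} : TimeTerm S n k → ℕ
  | .var x => Nat.pair 0 x
  | .num q => Nat.pair 1 (Nat.pair (Encodable.encode q.num) q.den)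
  | .fluent i args => Nat.pair 2 (Nat.pair i (argsCode args))
  | .rigid i args => Nat.pair 3 (Nat.pair i (argsCode args))
  | .add t u => Nat.pair 4 (Nat.pair t.code u.code)
  | .sub t u => Nat.pair 5 (Nat.pair t.code u.code)
  | .mul t u => Nat.pair 6 (Nat.pair t.code u.code)

/-- The code of a formula. -/
def Formula.code : {n m k : ℕ} → Formula S n m k → ℕ
  | _, _, _, .rel i args => Nat.pair 0 (Nat.pair i (argsCode args))
  | _, _, _, .rigidRel i args => Nat.pair 1 (Nat.pair i (argsCode args))
  | _, _, _, .eqObj t u => Nat.pair 2 (Nat.pair t.code u.code)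
  | _, _, _, .eqAct t u => Nat.pair 3 (Nat.pair t.code u.code)
  | _, _, _, .eqTime t u => Nat.pair 4 (Nat.pair t.code u.code)
  | _, _, _, .ltTime t u => Nat.pair 5 (Nat.pair t.code u.code)
  | _, _, _, .neg p => Nat.pair 6 p.code
  | _, _, _, .and p q => Nat.pair 7 (Nat.pair p.code q.code)
  | _, _, _, .allObj p => Nat.pair 8 p.code
  | _, _, _, .allAct p => Nat.pair 9 p.code
  | _, _, _, .allTime p => Nat.pair 10 p.code

/-- The code of a signature. -/
def Signature.code (S : Signature) : ℕ :=
  Encodable.encode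
    (S.objects, [S.actions, S.relFluents, S.objFluents, S.timeFluents, S.rigidRels,
      S.rigidObjFuns, S.rigidTimeFuns])

/-- The code of a theory. -/
def BAT.code (D : BAT S) : ℕ :=
  Encodable.encode
    [D.init.map Formula.code,
      List.ofFn fun i => (D.poss i).code,
      List.ofFn fun i => (D.ssaRel i).code,
      List.ofFn fun i => (D.ssaObj i).code,
      List.ofFn fun i => (D.ssaTime i).code]

/-- An input of the reachability problem: a theory and a property. -/
structure Input where
  sig : Signature
  theory : BAT sig
  property : Sentence sig

/-- The code of an input. -/
def Input.code (I : Input) : ℕ :=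
  Nat.pair I.sig.code (Nat.pair I.theory.code I.property.code)

/-- The theory is real-valued: it has a fluent of sort time. -/
def Input.RealValued (I : Input) : Prop :=
  I.sig.timeFluents ≠ []

/-- An algorithm that, for every real-valued basic action theory with complete information which is
consistent together with the condition `K` on the sort time, and for every property, decides
whether the property is reachable. On all other numbers the answer is arbitrary. -/
def DecidableReachability (K : ∀ S : Signature, Interpretation S → Prop) : Prop :=
  ∃ f : ℕ → Bool, Computable f ∧
    ∀ I : Input, I.RealValued → I.theory.CompleteInformation → I.theory.Consistent (K I.sig) →
      (f I.code = true ↔ I.theory.EntailsReachable (K I.sig) I.property)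

theorem ObjTerm.code_injective {n : ℕ} : Function.Injective (ObjTerm.code : ObjTerm S n → ℕ) := by
  intro t
  induction t with
  | var x => intro u h; cases u <;> simp_all [ObjTerm.code, Fin.ext_iff]
  | const x => intro u h; cases u <;> simp_all [ObjTerm.code, Fin.ext_iff]
  | fluent i args ih =>
    intro u h
    cases u with
    | fluent j args' =>
      simp only [ObjTerm.code, Nat.pair_eq_pair, true_and] at h
      obtain ⟨h1, h2⟩ := h
      obtain rfl := Fin.ext h1
      have h3 := List.ofFn_injective (Encodable.encode_injective h2)
      congr 1
      exact funext fun j => ih j (congrFun h3 j)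
    | _ => simp [ObjTerm.code] at h
  | rigid i args ih =>
    intro u h
    cases u with
    | rigid j args' =>
      simp only [ObjTerm.code, Nat.pair_eq_pair, true_and] at h
      obtain ⟨h1, h2⟩ := h
      obtain rfl := Fin.ext h1
      have h3 := List.ofFn_injective (Encodable.encode_injective h2)
      congr 1
      exact funext fun j => ih j (congrFun h3 j)
    | _ => simp [ObjTerm.code] at h

theorem argsCode_injective {n r : ℕ} :
    Function.Injective (argsCode : (Fin r → ObjTerm S n) → ℕ) := by
  intro a b h
  have h3 := List.ofFn_injective (Encodable.encode_injective h)
  exact funext fun j => ObjTerm.code_injective (congrFun h3 j)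

theorem ActTerm.code_injective {n m : ℕ} :
    Function.Injective (ActTerm.code : ActTerm S n m → ℕ) := by
  intro t u h
  cases t with
  | var x => cases u <;> simp_all [ActTerm.code, Fin.ext_iff]
  | app i args =>
    cases u with
    | var x => simp [ActTerm.code] at h
    | app j args' =>
      simp only [ActTerm.code, Nat.pair_eq_pair, true_and] at h
      obtain ⟨h1, h2⟩ := h
      obtain rfl := Fin.ext h1
      rw [argsCode_injective h2]

theorem TimeTerm.code_injective {n k : ℕ} :
    Function.Injective (TimeTerm.code : TimeTerm S n k → ℕ) := by
  intro t
  induction t with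
  | var x => intro u h; cases u <;> simp_all [TimeTerm.code, Fin.ext_iff]
  | num q => intro u h; cases u <;> simp_all [TimeTerm.code]; exact Rat.ext h.1 h.2
  | fluent i args =>
    intro u h
    cases u with
    | fluent j args' =>
      simp only [TimeTerm.code, Nat.pair_eq_pair, true_and] at h
      obtain ⟨h1, h2⟩ := h
      obtain rfl := Fin.ext h1
      rw [argsCode_injective h2]
    | _ => simp [TimeTerm.code] at h
  | rigid i args =>
    intro u h
    cases u with
    | rigid j args' =>
      simp only [TimeTerm.code, Nat.pair_eq_pair, true_and] at h
      obtain ⟨h1, h2⟩ := h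
      obtain rfl := Fin.ext h1
      rw [argsCode_injective h2]
    | _ => simp [TimeTerm.code] at h
  | add a b iha ihb | sub a b iha ihb | mul a b iha ihb =>
    intro u h
    cases u <;> simp [TimeTerm.code] at h
    rw [iha h.1, ihb h.2]

theorem Formula.code_injective {n m k : ℕ} :
    Function.Injective (Formula.code : Formula S n m k → ℕ) := by
  intro p
  induction p with
  | rel i args =>
    intro q h
    cases q with
    | rel j args' =>
      simp only [Formula.code, Nat.pair_eq_pair, true_and] at h
      obtain ⟨h1, h2⟩ := h
      obtain rfl := Fin.ext h1
      rw [argsCode_injective h2]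
    | _ => simp [Formula.code] at h
  | rigidRel i args =>
    intro q h
    cases q with
    | rigidRel j args' =>
      simp only [Formula.code, Nat.pair_eq_pair, true_and] at h
      obtain ⟨h1, h2⟩ := h
      obtain rfl := Fin.ext h1
      rw [argsCode_injective h2]
    | _ => simp [Formula.code] at h
  | eqObj t u =>
    intro q h
    cases q <;> simp [Formula.code] at h
    rw [ObjTerm.code_injective h.1, ObjTerm.code_injective h.2]
  | eqAct t u =>
    intro q h
    cases q <;> simp [Formula.code] at h
    rw [ActTerm.code_injective h.1, ActTerm.code_injective h.2]
  | eqTime t u | ltTime t u =>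
    intro q h
    cases q <;> simp [Formula.code] at h
    rw [TimeTerm.code_injective h.1, TimeTerm.code_injective h.2]
  | and a b iha ihb =>
    intro q h
    cases q <;> simp [Formula.code] at h
    rw [iha h.1, ihb h.2]
  | neg a ih | allObj a ih | allAct a ih | allTime a ih =>
    intro q h
    cases q <;> simp [Formula.code] at h
    rw [ih h]

theorem Input.code_injective : Function.Injective Input.code := by
  rintro ⟨S, D, p⟩ ⟨S', D', p'⟩ h
  simp only [Input.code, Nat.pair_eq_pair] at h
  obtain ⟨h1, h2, h3⟩ := h
  have h1' := Encodable.encode_injective h1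
  have hS : S = S' := by
    cases S; cases S'; simp_all
  subst hS
  rw [Formula.code_injective h3]
  have h2' := Encodable.encode_injective h2
  simp only [List.cons.injEq, and_true] at h2'
  obtain ⟨a1, a2, a3, a4, a5⟩ := h2'
  have b1 := List.map_injective_iff.mpr Formula.code_injective a1
  have b2 : D.poss = D'.poss := funext fun i =>
    Formula.code_injective (congrFun (List.ofFn_injective a2) i)
  have b3 : D.ssaRel = D'.ssaRel := funext fun i =>
    Formula.code_injective (congrFun (List.ofFn_injective a3) i)
  have b4 : D.ssaObj = D'.ssaObj := funext fun i =>
    Formula.code_injective (congrFun (List.ofFn_injective a4) i)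
  have b5 : D.ssaTime = D'.ssaTime := funext fun i =>
    Formula.code_injective (congrFun (List.ofFn_injective a5) i)
  have hD : D = D' := by
    cases D; cases D'; simp_all
  rw [hD]

end SitCalc

/-! The halting problem reduces to bounded reachability. A bound on the size of a real number does
not bound its precision, so a single real in `[0, 1)` can hold a whole stack as its base-5
expansion, and push, pop and inspection of the top are polynomial assignments and comparisons. A
machine with four stacks and finitely many states, hence any partial recursive function
(`exists_stackMachine`), thus becomes a finite system of guarded assignments to real registers that
never exceed 1.

Such a system is a basic action theory: one action type per rule, one argument-free time fluent per
register, quantifier-free axioms. Every model of it, whatever its time sort, has the same reachable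
register values (`Interpretation.Models.exists_exec_iff`), so for a consistent theory entailment is
plain reachability (`RegSystem.entailsReachable_iff`). A model on finite action sequences, whose
time sort may be any set containing the register values, gives consistency under both readings of
the bound.

Only the initial axioms depend on the input `n`, through the rational `2⁻ⁿ`. The system guesses the
binary digits of a number `m`, pushing them on the main stack while maintaining `2⁻ᵐ`, and may start
the machine only when `2⁻ᵐ = 2⁻ⁿ`. Halting is then reachability of one value of the program counter
(`reaches_halt_iff`), and `n` is mapped to the code of the instance by a primitive recursive
function (`primrec_code_haltInput`). -/

namespace SitCalc

/-! ### Derived connectives -/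

section Connectives

variable {S : Signature} {n m k : ℕ}

/-- Implication. -/
def Formula.imp (p q : Formula S n m k) : Formula S n m k := .neg (.and p (.neg q))

/-- The conjunction of a list of formulas. -/
def Formula.conj (l : List (Formula S n m k)) : Formula S n m k :=
  l.foldr .and (.eqTime (.num 0) (.num 0))

variable {M : Interpretation S} {s : M.Sit} {o : Fin n → M.Obj} {a : Fin m → M.Act}
  {t : Fin k → ℝ}

theorem Formula.holds_imp {p q : Formula S n m k} :
    (p.imp q).Holds M s o a t ↔ (p.Holds M s o a t → q.Holds M s o a t) := by
  simp [Formula.imp, Formula.Holds]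

theorem Formula.holds_conj {l : List (Formula S n m k)} :
    (Formula.conj l).Holds M s o a t ↔ ∀ p ∈ l, p.Holds M s o a t := by
  induction l with
  | nil => simp [Formula.conj, Formula.Holds]
  | cons p l ih => simpa [Formula.conj, Formula.Holds] using fun _ => ih

end Connectives

/-! ### Register systems -/

/-- Polynomial expressions over real registers. -/
inductive RExpr (ι : Type) : Type
  | reg (j : ι) : RExpr ι
  | num (q : ℚ) : RExpr ι
  | add (e f : RExpr ι) : RExpr ι
  | sub (e f : RExpr ι) : RExpr ι
  | mul (e f : RExpr ι) : RExpr ι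

/-- Quantifier-free conditions on real registers. -/
inductive RTest (ι : Type) : Type
  | eq (e f : RExpr ι) : RTest ι
  | lt (e f : RExpr ι) : RTest ι
  | not (c : RTest ι) : RTest ι
  | and (c d : RTest ι) : RTest ι

variable {ι ρ : Type}

/-- The value of an expression. -/
def RExpr.eval (v : ι → ℝ) : RExpr ι → ℝ
  | .reg j => v j
  | .num q => q
  | .add e f => e.eval v + f.eval v
  | .sub e f => e.eval v - f.eval v
  | .mul e f => e.eval v * f.eval v

/-- Truth of a condition. -/
def RTest.Holds (v : ι → ℝ) : RTest ι → Prop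
  | .eq e f => e.eval v = f.eval v
  | .lt e f => e.eval v < f.eval v
  | .not c => ¬ c.Holds v
  | .and c d => c.Holds v ∧ d.Holds v

/-- A system of guarded simultaneous assignments to real registers. -/
structure RegSystem (ι ρ : Type) where
  /-- the condition under which a rule applies -/
  guard : ρ → RTest ι
  /-- the new values of the registers -/
  update : ρ → ι → RExpr ι

open scoped Classical in
/-- The registers after an attempt to apply a rule; nothing changes if it does not apply. -/
noncomputable def RegSystem.next (P : RegSystem ι ρ) (i : ρ) (v : ι → ℝ) : ι → ℝ :=
  fun j => if (P.guard i).Holds v then (P.update i j).eval v else v j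

/-- One rule applies and leads from `v` to `w`. -/
def RegSystem.Step (P : RegSystem ι ρ) (v w : ι → ℝ) : Prop :=
  ∃ i, (P.guard i).Holds v ∧ w = P.next i v

/-- `w` is reached from `v` by applying rules. -/
def RegSystem.Reaches (P : RegSystem ι ρ) : (ι → ℝ) → (ι → ℝ) → Prop :=
  Relation.ReflTransGen P.Step

/-- A failed attempt leaves the registers alone. This is why a bound on reachable values also holds
in the non-executable situations, which reading (i) includes. -/
theorem RegSystem.Reaches.next {P : RegSystem ι ρ} {v w : ι → ℝ} (h : P.Reaches v w) (i : ρ) :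
    P.Reaches v (P.next i w) := by
  by_cases hg : (P.guard i).Holds w
  · exact h.tail ⟨i, hg, rfl⟩
  · have : P.next i w = w := funext fun j => if_neg hg
    rwa [this]

/-- The values of the registers after a sequence of actions. -/
noncomputable def RegSystem.run (P : RegSystem ι ρ) (v : ι → ℝ) : List ρ → ι → ℝ
  | [] => v
  | i :: s => P.next i (P.run v s)

theorem RegSystem.reaches_run (P : RegSystem ι ρ) (v : ι → ℝ) (s : List ρ) :
    P.Reaches v (P.run v s) := by
  induction s with
  | nil => exact Relation.ReflTransGen.refl
  | cons i s ih => exact ih.next i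

/-! ### The basic action theory of a register system -/

variable [Fintype ι] [Fintype ρ]

/-- One object, one action without arguments per rule, one fluent of sort time without arguments
per register. -/
def regSig (ι ρ : Type) [Fintype ι] [Fintype ρ] : Signature where
  objects := 1
  actions := List.replicate (Fintype.card ρ) 0
  relFluents := []
  objFluents := []
  timeFluents := List.replicate (Fintype.card ι) 0
  rigidRels := []
  rigidObjFuns := []
  rigidTimeFuns := []

instance (i : Fin (regSig ι ρ).actions.length) : IsEmpty (Fin ((regSig ι ρ).actions.get i)) := by
  have : (regSig ι ρ).actions.get i = 0 := List.getElem_replicate i.2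
  rw [this]; infer_instance

instance (i : Fin (regSig ι ρ).timeFluents.length) :
    IsEmpty (Fin ((regSig ι ρ).timeFluents.get i)) := by
  have : (regSig ι ρ).timeFluents.get i = 0 := List.getElem_replicate i.2
  rw [this]; infer_instance

instance : IsEmpty (Fin (regSig ι ρ).relFluents.length) := inferInstanceAs (IsEmpty (Fin 0))
instance : IsEmpty (Fin (regSig ι ρ).objFluents.length) := inferInstanceAs (IsEmpty (Fin 0))
instance : IsEmpty (Fin (regSig ι ρ).rigidRels.length) := inferInstanceAs (IsEmpty (Fin 0))
instance : IsEmpty (Fin (regSig ι ρ).rigidObjFuns.length) := inferInstanceAs (IsEmpty (Fin 0))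
instance : IsEmpty (Fin (regSig ι ρ).rigidTimeFuns.length) := inferInstanceAs (IsEmpty (Fin 0))

/-- The numbering of the fluents of sort time by the registers. -/
noncomputable def regIx (ι ρ : Type) [Fintype ι] [Fintype ρ] :
    Fin (regSig ι ρ).timeFluents.length ≃ ι :=
  (finCongr (by simp [regSig])).trans (Fintype.equivFin ι).symm

/-- The numbering of the action types by the rules. -/
noncomputable def ruleIx (ι ρ : Type) [Fintype ι] [Fintype ρ] :
    Fin (regSig ι ρ).actions.length ≃ ρ :=
  (finCongr (by simp [regSig])).trans (Fintype.equivFin ρ).symm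

/-- The register `j` as a term. -/
noncomputable def regTerm (ρ : Type) [Fintype ρ] {n k : ℕ} (j : ι) : TimeTerm (regSig ι ρ) n k :=
  .fluent ((regIx ι ρ).symm j) isEmptyElim

/-- An expression as a term. -/
noncomputable def RExpr.toTerm (ρ : Type) [Fintype ρ] {n k : ℕ} :
    RExpr ι → TimeTerm (regSig ι ρ) n k
  | .reg j => regTerm ρ j
  | .num q => .num q
  | .add e f => .add (e.toTerm ρ) (f.toTerm ρ)
  | .sub e f => .sub (e.toTerm ρ) (f.toTerm ρ)
  | .mul e f => .mul (e.toTerm ρ) (f.toTerm ρ)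

/-- A condition as a formula. -/
noncomputable def RTest.toFormula (ρ : Type) [Fintype ρ] {n m k : ℕ} :
    RTest ι → Formula (regSig ι ρ) n m k
  | .eq e f => .eqTime (e.toTerm ρ) (f.toTerm ρ)
  | .lt e f => .ltTime (e.toTerm ρ) (f.toTerm ρ)
  | .not c => .neg (c.toFormula ρ)
  | .and c d => .and (c.toFormula ρ) (d.toFormula ρ)

/-- The register `j` has the value `q`. -/
noncomputable def initFormula (ρ : Type) [Fintype ρ] (q : ι → ℚ) (j : ι) : Sentence (regSig ι ρ) :=
  .eqTime (regTerm ρ j) (.num (q j))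

/-- The effect of the rule `i` on the register `j`, if the action variable is that rule. -/
noncomputable def RegSystem.effect (P : RegSystem ι ρ) {n : ℕ} (j : ι)
    (i : Fin (regSig ι ρ).actions.length) : Formula (regSig ι ρ) n 1 1 :=
  .imp (.eqAct (.var 0) (.app i isEmptyElim)) <|
    let g := (P.guard (ruleIx ι ρ i)).toFormula ρ
    -- Successor state axioms also govern impossible actions, so the case of a false guard must fix
    -- the new value too.
    .and (.imp g (.eqTime (.var 0) ((P.update (ruleIx ι ρ i) j).toTerm ρ)))
      (.imp (.neg g) (.eqTime (.var 0) (regTerm ρ j)))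

/-- The basic action theory of a register system with initial values `q`. -/
noncomputable def RegSystem.bat (P : RegSystem ι ρ) (q : ι → ℚ) : BAT (regSig ι ρ) where
  init := List.ofFn fun i => initFormula ρ q (regIx ι ρ i)
  poss i := (P.guard (ruleIx ι ρ i)).toFormula ρ
  ssaRel := isEmptyElim
  ssaObj := isEmptyElim
  ssaTime i := .conj (List.ofFn (P.effect (regIx ι ρ i)))

/-- The values of the registers in a situation. -/
noncomputable def Interpretation.regs (M : Interpretation (regSig ι ρ)) (s : M.Sit) : ι → ℝ :=
  fun j => M.timeFluent ((regIx ι ρ).symm j) isEmptyElim s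

section Semantics

variable {M : Interpretation (regSig ι ρ)} {s : M.Sit} {n m k : ℕ} {o : Fin n → M.Obj}
  {a : Fin m → M.Act} {t : Fin k → ℝ}

theorem eval_regTerm (j : ι) : (regTerm ρ j).eval M s o t = M.regs s j := by
  simp only [regTerm, TimeTerm.eval, Interpretation.regs]
  congr 1
  exact Subsingleton.elim _ _

theorem timeFluent_eq_regs (i : Fin (regSig ι ρ).timeFluents.length)
    (x : Fin ((regSig ι ρ).timeFluents.get i) → M.Obj) :
    M.timeFluent i x s = M.regs s (regIx ι ρ i) := by
  obtain ⟨j, rfl⟩ := (regIx ι ρ).symm.surjective i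
  rw [Equiv.apply_symm_apply, Interpretation.regs]
  congr 1
  exact Subsingleton.elim _ _

theorem RExpr.eval_toTerm (e : RExpr ι) : (e.toTerm ρ).eval M s o t = e.eval (M.regs s) := by
  induction e with
  | reg j => exact eval_regTerm j
  | num q => rfl
  | add e f he hf | sub e f he hf | mul e f he hf => simp [toTerm, TimeTerm.eval, eval, he, hf]

theorem RTest.holds_toFormula (c : RTest ι) :
    (c.toFormula ρ).Holds M s o a t ↔ c.Holds (M.regs s) := by
  induction c with
  | eq e f => simp [toFormula, Formula.Holds, Holds, RExpr.eval_toTerm]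
  | lt e f => simp [toFormula, Formula.Holds, Holds, RExpr.eval_toTerm]
  | not c hc => simp [toFormula, Formula.Holds, Holds, hc]
  | and c d hc hd => simp [toFormula, Formula.Holds, Holds, hc, hd]

theorem RegSystem.holds_effect (P : RegSystem ι ρ) (j : ι)
    (i : Fin (regSig ι ρ).actions.length) (a : Fin 1 → M.Act) (t : Fin 1 → ℝ) :
    (P.effect j i).Holds M s o a t ↔
      (a 0 = M.act i isEmptyElim → t 0 = P.next (ruleIx ι ρ i) (M.regs s) j) := by
  have : (fun j => ObjTerm.eval M s o (isEmptyElim j)) =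
    (isEmptyElim : Fin ((regSig ι ρ).actions.get i) → M.Obj) := Subsingleton.elim _ _
  simp only [effect, Formula.holds_imp, Formula.Holds, ActTerm.eval, TimeTerm.eval,
    RTest.holds_toFormula, RExpr.eval_toTerm, eval_regTerm, next, this]
  by_cases h : (P.guard (ruleIx ι ρ i)).Holds (M.regs s) <;> simp [h]

theorem RegSystem.holds_ssaTime (P : RegSystem ι ρ) (q : ι → ℚ)
    (j : Fin (regSig ι ρ).timeFluents.length) {M : Interpretation (regSig ι ρ)} {s : M.Sit}
    (o : Fin ((regSig ι ρ).timeFluents.get j) → M.Obj) (a : Fin 1 → M.Act) (t : Fin 1 → ℝ) :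
    ((P.bat q).ssaTime j).Holds M s o a t ↔ ∀ i, a 0 = M.act i isEmptyElim →
      t 0 = P.next (ruleIx ι ρ i) (M.regs s) (regIx ι ρ j) := by
  simp only [bat, Formula.holds_conj, List.forall_mem_ofFn_iff, holds_effect]

theorem satisfied_init (q : ι → ℚ) :
    (∀ φ ∈ (List.ofFn fun i => initFormula ρ q (regIx ι ρ i)), Sentence.Satisfied M s φ) ↔
      M.regs s = fun j => (q j : ℝ) := by
  simp only [List.forall_mem_ofFn_iff, Sentence.Satisfied, initFormula, Formula.Holds,
    eval_regTerm, TimeTerm.eval, (regIx ι ρ).forall_congr_left, Equiv.apply_symm_apply,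
    funext_iff]

end Semantics

/-! ### Models of the theory of a register system -/

section Models

variable {P : RegSystem ι ρ} {q : ι → ℚ} {M : Interpretation (regSig ι ρ)}

/-- The action of a rule. -/
noncomputable def Interpretation.ruleAct (M : Interpretation (regSig ι ρ)) (i : ρ) : M.Act :=
  M.act ((ruleIx ι ρ).symm i) isEmptyElim

theorem Interpretation.Models.eq_ruleAct (h : M.Models (P.bat q)) (a : M.Act) :
    ∃ i, a = M.ruleAct i := by
  obtain ⟨i, o, rfl⟩ := h.act_closure a
  obtain ⟨i, rfl⟩ := (ruleIx ι ρ).symm.surjective i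
  exact ⟨i, congrArg _ (Subsingleton.elim _ _)⟩

theorem Interpretation.Models.regs_init (h : M.Models (P.bat q)) :
    M.regs M.s₀ = fun j => (q j : ℝ) :=
  (satisfied_init q).1 h.init

theorem Interpretation.Models.regs_do (h : M.Models (P.bat q)) (i : ρ) (s : M.Sit) :
    M.regs (M.doAct (M.ruleAct i) s) = P.next i (M.regs s) := by
  funext j
  -- The axiom is read at `y` equal to the actual new value, which lies in the time sort of any
  -- model; no further property of that sort is needed.
  have h1 := (h.ssaTime ((regIx ι ρ).symm j) isEmptyElim _
    (M.timeFluent_mem _ isEmptyElim _) (M.ruleAct i) s).1 rfl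
  rw [RegSystem.holds_ssaTime] at h1
  have h2 := h1 ((ruleIx ι ρ).symm i) rfl
  rwa [Equiv.apply_symm_apply, Equiv.apply_symm_apply] at h2

theorem Interpretation.Models.poss_ruleAct (h : M.Models (P.bat q)) (i : ρ) (s : M.Sit) :
    M.Poss (M.ruleAct i) s ↔ (P.guard i).Holds (M.regs s) := by
  rw [ruleAct, h.poss]
  simp only [RegSystem.bat, RTest.holds_toFormula, Equiv.apply_symm_apply]

theorem Interpretation.Foundational.exec_init {S : Signature} {M : Interpretation S}
    (h : M.Foundational) : M.Exec M.s₀ := by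
  rintro a s (h1 | h1)
  · exact absurd h1 (h.not_prec_s₀ _)
  -- If `do(a, s)` were the initial situation, then `s` would precede it.
  · exact absurd (h1 ▸ (h.prec_do a s s).2 (Or.inr rfl)) (h.not_prec_s₀ s)

theorem Interpretation.Foundational.exec_do {S : Signature} {M : Interpretation S}
    (h : M.Foundational) (a : M.Act) (s : M.Sit) :
    M.Exec (M.doAct a s) ↔ M.Exec s ∧ M.Poss a s := by
  constructor
  · exact fun h1 => ⟨fun a' s' h2 => h1 a' s' (Or.inl ((h.prec_do _ _ _).2 h2)),
      h1 a s (Or.inr rfl)⟩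
  · rintro ⟨h1, h2⟩ a' s' (h3 | h3)
    · exact h1 a' s' ((h.prec_do _ _ _).1 h3)
    · obtain ⟨rfl, rfl⟩ := h.do_inj _ _ _ _ h3
      exact h2

/-- The right-hand side does not mention `M`: all models agree on what is reachable. Second-order
induction over situations gives one direction, induction over runs of the system the other. -/
theorem Interpretation.Models.exists_exec_iff (h : M.Models (P.bat q)) (C : (ι → ℝ) → Prop) :
    (∃ s, M.Exec s ∧ C (M.regs s)) ↔ ∃ v, P.Reaches (fun j => (q j : ℝ)) v ∧ C v := by
  constructor
  · rintro ⟨s, hs, hC⟩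
    refine ⟨_, ?_, hC⟩
    revert hs
    clear hC
    refine h.foundational.induction
      (fun s => M.Exec s → P.Reaches (fun j => (q j : ℝ)) (M.regs s)) ?_ ?_ s
    · intro _
      rw [h.regs_init]
      exact Relation.ReflTransGen.refl
    · intro a s ih hs
      obtain ⟨i, rfl⟩ := h.eq_ruleAct a
      rw [h.regs_do]
      exact (ih ((h.foundational.exec_do _ _).1 hs).1).next i
  · rintro ⟨v, hv, hC⟩
    suffices H : ∃ s, M.Exec s ∧ M.regs s = v by
      obtain ⟨s, h1, h2⟩ := H
      exact ⟨s, h1, h2 ▸ hC⟩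
    clear hC
    induction hv with
    | refl => exact ⟨M.s₀, h.foundational.exec_init, h.regs_init⟩
    | tail _ hstep ih =>
      obtain ⟨s, h1, rfl⟩ := ih
      obtain ⟨i, hi, rfl⟩ := hstep
      exact ⟨M.doAct (M.ruleAct i) s,
        (h.foundational.exec_do _ _).2 ⟨h1, (h.poss_ruleAct i s).2 hi⟩, h.regs_do i s⟩

/-- The structure whose situations are the finite sequences of rules. -/
noncomputable def RegSystem.interp (P : RegSystem ι ρ) [Nonempty ρ] (v : ι → ℝ) (T : Set ℝ)
    (hT : ∀ s j, P.run v s j ∈ T) : Interpretation (regSig ι ρ) where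
  Obj := Unit
  Act := ρ
  Sit := List ρ
  timeDom := T
  obj_nonempty := inferInstance
  act_nonempty := inferInstance
  const _ := ()
  act i _ := ruleIx ι ρ i
  s₀ := []
  doAct i s := i :: s
  prec s s' := s <:+ s' ∧ s ≠ s'
  Poss i s := (P.guard i).Holds (P.run v s)
  rel := isEmptyElim
  objFluent := isEmptyElim
  timeFluent j _ s := P.run v s (regIx ι ρ j)
  rigidRel := isEmptyElim
  rigidObjFun := isEmptyElim
  rigidTimeFun := isEmptyElim
  timeFluent_mem _ _ s := hT s _
  rigidTimeFun_mem := isEmptyElim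

theorem RegSystem.regs_interp [Nonempty ρ] (v : ι → ℝ) (T : Set ℝ)
    (hT : ∀ s j, P.run v s j ∈ T) (s : (P.interp v T hT).Sit) :
    (P.interp v T hT).regs s = P.run v s :=
  funext fun j => congrArg (P.run v s) ((regIx ι ρ).apply_symm_apply j)

theorem suffix_and_ne_cons_iff {α : Type*} (a : α) (s s' : List α) :
    (s <:+ a :: s' ∧ s ≠ a :: s') ↔ ((s <:+ s' ∧ s ≠ s') ∨ s = s') := by
  have h1 : s <:+ s' → s ≠ a :: s' := by
    rintro h rfl
    exact absurd h.length_le (by simp)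
  rw [List.suffix_cons_iff]
  by_cases h : s = s'
  · subst h; simp
  · tauto

/-- All axioms are quantifier-free, so the time sort `T` matters only through `hT`. This lets one
construction serve both readings of the bound. -/
theorem RegSystem.interp_models [Nonempty ρ] (T : Set ℝ)
    (hT : ∀ s j, P.run (fun j => (q j : ℝ)) s j ∈ T) :
    (P.interp (fun j => (q j : ℝ)) T hT).Models (P.bat q) where
  init := (satisfied_init q).2 (regs_interp _ T hT [])
  poss i o s := by
    refine Iff.trans ?_ (RTest.holds_toFormula _).symm
    rw [regs_interp]
    exact Iff.rfl
  ssaRel := isEmptyElim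
  ssaObj := isEmptyElim
  ssaTime j o y _ a s := by
    rw [holds_ssaTime, regs_interp]
    constructor
    · rintro rfl i h
      obtain rfl : a = ruleIx ι ρ i := h
      rfl
    · intro h
      obtain ⟨i, rfl⟩ := (ruleIx ι ρ).surjective a
      exact (h i rfl).symm
  act_unique := by
    rintro ⟨i, o⟩ ⟨i', o'⟩ h
    obtain rfl := (ruleIx ι ρ).injective h
    exact congrArg _ (Subsingleton.elim _ _)
  act_closure a := ⟨(ruleIx ι ρ).symm a, isEmptyElim, ((ruleIx ι ρ).apply_symm_apply a).symm⟩
  obj_unique _ _ _ := Subsingleton.elim (α := Fin 1) _ _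
  obj_closure _ := ⟨(0 : Fin 1), rfl⟩
  foundational :=
    { do_inj := fun _ _ _ _ h => List.cons.inj h
      induction := fun Q h0 h1 s => List.rec h0 (fun a s h => h1 a s h) s
      not_prec_s₀ := fun s h => h.2 (List.suffix_nil.1 h.1)
      prec_do := suffix_and_ne_cons_iff }

/-- There is one object, there are no rigid symbols, and the initial axioms give each fluent a
rational value; hence a closed atomic formula has the same initial truth value in all models. -/
theorem RegSystem.completeInformation (P : RegSystem ι ρ) (q : ι → ℚ) :
    (P.bat q).CompleteInformation := by
  have key : ∀ φ : Sentence (regSig ι ρ), φ.IsAtomic → ∀ M M' : Interpretation (regSig ι ρ),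
      M.Models (P.bat q) → M'.Models (P.bat q) →
      (Sentence.Satisfied M M.s₀ φ → Sentence.Satisfied M' M'.s₀ φ) := by
    intro φ hφ M M' hM hM'
    have hobj : ∀ M : Interpretation (regSig ι ρ), M.Models (P.bat q) → Subsingleton M.Obj := by
      intro M hM
      refine ⟨fun x y => ?_⟩
      obtain ⟨c, rfl⟩ := hM.obj_closure x
      obtain ⟨d, rfl⟩ := hM.obj_closure y
      exact congrArg _ (Subsingleton.elim (α := Fin 1) _ _)
    have htime : ∀ t : TimeTerm (regSig ι ρ) 0 0,
        t.eval M M.s₀ Fin.elim0 Fin.elim0 = t.eval M' M'.s₀ Fin.elim0 Fin.elim0 := by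
      intro t
      induction t with
      | var x => exact x.elim0
      | num q => rfl
      | fluent i args =>
        simp only [TimeTerm.eval, timeFluent_eq_regs, hM.regs_init, hM'.regs_init]
      | rigid i => exact (IsEmpty.false i).elim
      | add t u ht hu | sub t u ht hu | mul t u ht hu => simp only [TimeTerm.eval, ht, hu]
    match φ, hφ with
    | .rel i _, _ => exact (IsEmpty.false i).elim
    | .rigidRel i _, _ => exact (IsEmpty.false i).elim
    | .eqObj t u, _ => exact fun _ => (hobj M' hM').elim _ _
    | .eqAct (.var x) _, _ => exact x.elim0
    | .eqAct _ (.var x), _ => exact x.elim0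
    | .eqAct (.app i x) (.app j y), _ =>
      intro h
      -- Unique names force equal action types, and the types have no arguments, so the two terms
      -- agree in every model.
      have := congrArg Sigma.fst (@hM.act_unique ⟨i, _⟩ ⟨j, _⟩ h)
      obtain rfl : i = j := this
      exact congrArg (M'.act i) (Subsingleton.elim _ _)
    | .eqTime t u, _ => simp only [Sentence.Satisfied, Formula.Holds, htime, imp_self]
    | .ltTime t u, _ => simp only [Sentence.Satisfied, Formula.Holds, htime, imp_self]
  intro φ hφ
  by_cases h : ∃ M : Interpretation (regSig ι ρ), M.Models (P.bat q) ∧ Sentence.Satisfied M M.s₀ φ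
  · obtain ⟨M, hM, h⟩ := h
    exact Or.inl fun M' _ hM' => key φ hφ M M' hM hM' h
  · exact Or.inr fun M' _ hM' h' => h ⟨M', hM', h'⟩

/-- Consistency supplies a model from which an actual run can be read off; without one, entailment
would hold vacuously. -/
theorem RegSystem.entailsReachable_iff {K : Interpretation (regSig ι ρ) → Prop}
    (hK : (P.bat q).Consistent K) (c : RTest ι) :
    (P.bat q).EntailsReachable K (c.toFormula ρ) ↔
      ∃ v, P.Reaches (fun j => (q j : ℝ)) v ∧ c.Holds v := by
  simp only [BAT.EntailsReachable, Sentence.Satisfied, RTest.holds_toFormula]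
  constructor
  · intro h
    obtain ⟨M, hM, hM'⟩ := hK
    exact (hM'.exists_exec_iff _).1 (h M hM hM')
  · exact fun h M _ hM => (hM.exists_exec_iff _).2 h

theorem RegSystem.consistent_fluentsBounded [Nonempty ρ] {b : ℝ}
    (h : ∀ v, P.Reaches (fun j => (q j : ℝ)) v → ∀ j, v j ≤ b) :
    (P.bat q).Consistent fun M => M.FluentsBounded b :=
  ⟨P.interp _ Set.univ fun _ _ => Set.mem_univ _,
    ⟨rfl, fun _ _ s => h _ (P.reaches_run _ s) _⟩, interp_models _ _⟩

theorem RegSystem.consistent_sortBounded [Nonempty ρ] {b : ℝ}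
    (h : ∀ v, P.Reaches (fun j => (q j : ℝ)) v → ∀ j, v j ≤ b) :
    (P.bat q).Consistent fun M => M.SortBounded b :=
  ⟨P.interp _ (Set.Iic b) fun s j => h _ (P.reaches_run _ s) j, rfl, interp_models _ _⟩

end Models

open Turing PartrecToTM2 StateTransition

/-! ### Stack machines -/

/-- An instruction of a machine with the stacks `K'`, with its successor states. -/
inductive StackInstr (Q : Type) : Type
  | push (k : K') (a : Γ') (q : Q) : StackInstr Q
  | peek (k : K') (q : Option Γ' → Q) : StackInstr Q
  | pop (k : K') (q : Option Γ' → Q) : StackInstr Q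
  | jump (q : Q) : StackInstr Q

/-- The effect of an instruction. -/
def StackInstr.exec {Q : Type} (T : K' → List Γ') : StackInstr Q → Q × (K' → List Γ')
  | .push k a q => (q, Function.update T k (a :: T k))
  | .peek k q => (q (T k).head?, T)
  | .pop k q => (q (T k).head?, Function.update T k (T k).tail)
  | .jump q => (q, T)

/-- A step of a stack machine; `none` is the halting state. -/
def stackStep {Q : Type} (prog : Q → StackInstr (Option Q)) :
    Option Q × (K' → List Γ') → Option (Option Q × (K' → List Γ'))
  | (none, _) => none
  | (some q, T) => some ((prog q).exec T)

theorem eval_stackStep_dom {Q : Type} {prog : Q → StackInstr (Option Q)}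
    (c : Option Q × (K' → List Γ')) :
    (eval (stackStep prog) c).Dom ↔ ∃ T, StateTransition.Reaches (stackStep prog) c (none, T) := by
  rw [Part.dom_iff_mem]
  constructor
  · rintro ⟨⟨_ | q, T⟩, h⟩
    · exact ⟨T, (mem_eval.1 h).1⟩
    · cases (mem_eval.1 h).2
  · rintro ⟨T, h⟩
    exact ⟨_, mem_eval.2 ⟨h, rfl⟩⟩

section TM2

variable {Λ σ : Type}

/-- The instruction of the stack machine that works through the statements of a `TM2` program one
after the other. -/
def stmtInstr (M : Λ → TM2.Stmt (fun _ : K' => Γ') Λ σ) :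
    TM2.Stmt (fun _ : K' => Γ') Λ σ × σ →
      StackInstr (Option (TM2.Stmt (fun _ : K' => Γ') Λ σ × σ))
  | (.push k f q, s) => .push k (f s) (some (q, s))
  | (.peek k f q, s) => .peek k fun o => some (q, f s o)
  | (.pop k f q, s) => .pop k fun o => some (q, f s o)
  | (.load f q, s) => .jump (some (q, f s))
  | (.branch f q₁ q₂, s) => .jump (some (cond (f s) q₁ q₂, s))
  | (.goto f, s) => .jump (some (M (f s), s))
  | (.halt, _) => .jump none

/-- The configuration of the stack machine at the beginning of a `TM2` step. -/
def stackCfg (M : Λ → TM2.Stmt (fun _ : K' => Γ') Λ σ)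
    (c : TM2.Cfg (fun _ : K' => Γ') Λ σ) :
    Option (TM2.Stmt (fun _ : K' => Γ') Λ σ × σ) × (K' → List Γ') :=
  (c.l.map fun l => (M l, c.var), c.stk)

/-- One `TM2` step executes a whole statement tree; here it is unfolded into a nonempty run of
single instructions, with the remaining statement and the internal memory as state. -/
theorem reaches₁_stepAux (M : Λ → TM2.Stmt (fun _ : K' => Γ') Λ σ)
    (q : TM2.Stmt (fun _ : K' => Γ') Λ σ) (s : σ) (T : K' → List Γ') :
    Reaches₁ (stackStep (stmtInstr M)) (some (q, s), T) (stackCfg M (TM2.stepAux q s T)) := by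
  induction q generalizing s T with
  | push k f q ih => exact Relation.TransGen.head rfl (ih _ _)
  | peek k f q ih => exact Relation.TransGen.head rfl (ih _ _)
  | pop k f q ih => exact Relation.TransGen.head rfl (ih _ _)
  | load f q ih => exact Relation.TransGen.head rfl (ih _ _)
  | branch f q₁ q₂ ih₁ ih₂ =>
    rw [TM2.stepAux]
    refine Relation.TransGen.head (b := (some (cond (f s) q₁ q₂, s), T)) rfl ?_
    cases f s
    · exact ih₂ _ _
    · exact ih₁ _ _
  | goto f => exact Relation.TransGen.single rfl
  | halt => exact Relation.TransGen.single rfl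

theorem respects_stackCfg (M : Λ → TM2.Stmt (fun _ : K' => Γ') Λ σ) :
    Respects (TM2.step M) (stackStep (stmtInstr M)) fun c d => d = stackCfg M c := by
  rintro ⟨_ | l, s, T⟩ _ rfl
  · rfl
  · exact ⟨_, rfl, reaches₁_stepAux M _ _ _⟩

/-- The states of the stack machine that occur in computations within the labels `S`. -/
noncomputable def stmtStates [Fintype σ] (M : Λ → TM2.Stmt (fun _ : K' => Γ') Λ σ)
    (S : Finset Λ) : Finset (TM2.Stmt (fun _ : K' => Γ') Λ σ × σ) :=
  (TM2.stmts M S).eraseNone ×ˢ Finset.univ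

theorem mem_stmtStates [Fintype σ] {M : Λ → TM2.Stmt (fun _ : K' => Γ') Λ σ}
    {S : Finset Λ} {q : TM2.Stmt (fun _ : K' => Γ') Λ σ × σ} :
    q ∈ stmtStates M S ↔ some q.1 ∈ TM2.stmts M S := by
  simp [stmtStates]

theorem some_mem_stmts {M : Λ → TM2.Stmt (fun _ : K' => Γ') Λ σ} {S : Finset Λ} {l : Λ}
    (h : l ∈ S) : some (M l) ∈ TM2.stmts M S := by
  simp only [TM2.stmts, Finset.some_mem_insertNone, Finset.mem_biUnion]
  exact ⟨l, h, TM2.stmts₁_self⟩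

theorem stmtStates_closed [Fintype σ] [Inhabited Λ] {M : Λ → TM2.Stmt (fun _ : K' => Γ') Λ σ}
    {S : Finset Λ} (hS : TM2.Supports M S) {q : TM2.Stmt (fun _ : K' => Γ') Λ σ × σ}
    (hq : q ∈ stmtStates M S) (T : K' → List Γ') :
    ∀ q' ∈ ((stmtInstr M q).exec T).1, q' ∈ stmtStates M S := by
  rw [mem_stmtStates] at hq
  intro q' hq'
  rw [mem_stmtStates]
  obtain ⟨q, s⟩ := q
  cases q with
  | push k f q | peek k f q | pop k f q | load f q =>
    obtain rfl := Option.some.inj hq'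
    exact TM2.stmts_trans (by simp [TM2.stmts₁, TM2.stmts₁_self]) hq
  | branch f q₁ q₂ =>
    obtain rfl := Option.some.inj hq'
    refine TM2.stmts_trans ?_ hq
    cases f s <;> simp [TM2.stmts₁, TM2.stmts₁_self]
  | goto f =>
    obtain rfl := Option.some.inj hq'
    exact some_mem_stmts (TM2.stmts_supportsStmt hS hq s)
  | halt => cases hq'

end TM2

/-- The stacks that hold the input `n`. -/
def inputStacks (n : ℕ) : K' → List Γ' := K'.elim (trList [n]) [] [] []

/-- Every partial recursive function is the halting function of a stack machine that only uses
finitely many states. -/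
theorem exists_stackMachine {g : ℕ →. ℕ} (hg : Partrec g) :
    ∃ (Q : Type) (prog : Q → StackInstr (Option Q)) (F : Finset Q) (q₀ : Q), q₀ ∈ F ∧
      (∀ q ∈ F, ∀ T, ∀ q' ∈ ((prog q).exec T).1, q' ∈ F) ∧
      ∀ n, (eval (stackStep prog) (some q₀, inputStacks n)).Dom ↔ (g n).Dom := by
  obtain ⟨c, hc⟩ := ToPartrec.Code.exists_code (Nat.Partrec'.part_iff₁.2 hg)
  -- `TM2.Supports` requires the default label to lie in the finite set, so the default is chosen to
  -- be the start label.
  let : Inhabited Λ' := ⟨trNormal c Cont'.halt⟩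
  have hS : TM2.Supports tr (codeSupp c Cont'.halt) := tr_supports c Cont'.halt
  refine ⟨_, stmtInstr tr, stmtStates tr (codeSupp c Cont'.halt), (tr (trNormal c Cont'.halt), none),
    mem_stmtStates.2 (some_mem_stmts hS.1), fun q hq T => stmtStates_closed hS hq T, fun n => ?_⟩
  have h1 := tr_eval_dom (respects_stackCfg tr) (a₁ := init c [n]) rfl
  have h2 := hc (n ::ᵥ List.Vector.nil)
  -- The result of the `TM2` machine is the image of `c.eval [n]` under a total map, so the two
  -- domains agree.
  rw [PartrecToTM2.tr_eval] at h1
  refine h1.trans ?_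
  change (c.eval [n]) = _ at h2
  rw [h2]
  exact Iff.rfl

/-! ### Stacks as real numbers -/

/-- A nonzero digit in base `5`. -/
def digit : Γ' → ℕ
  | .consₗ => 1
  | .cons => 2
  | .bit0 => 3
  | .bit1 => 4

theorem digit_injective : Function.Injective digit := by decide

theorem digit_bounds (a : Γ') : 1 ≤ (digit a : ℝ) ∧ (digit a : ℝ) ≤ 4 := by
  cases a <;> norm_num [digit]

/-- The real number whose expansion in base `5` is a given stack. -/
noncomputable def stackVal : List Γ' → ℝ
  | [] => 0
  | a :: l => (digit a + stackVal l) / 5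

theorem stackVal_bounds (l : List Γ') : 0 ≤ stackVal l ∧ stackVal l < 1 := by
  induction l with
  | nil => simp [stackVal]
  | cons a l ih =>
    have := digit_bounds a
    rw [stackVal]
    constructor <;> linarith

variable {ι : Type}

/-- The stack in the register `j` has the top `o`. -/
def topTest (j : ι) : Option Γ' → RTest ι
  | none => .eq (.reg j) (.num 0)
  | some a => .and (.not (.lt (.mul (.num 5) (.reg j)) (.num (digit a))))
      (.lt (.mul (.num 5) (.reg j)) (.num (digit a + 1)))

/-- The stack in the register `j` after removing the top `o`. -/
def popExpr (j : ι) : Option Γ' → RExpr ι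
  | none => .reg j
  | some a => .sub (.mul (.num 5) (.reg j)) (.num (digit a))

/-- The stack in the register `j` after pushing `a`. -/
def pushExpr (j : ι) (a : Γ') : RExpr ι :=
  .mul (.num (1 / 5)) (.add (.num (digit a)) (.reg j))

/-- Five times the value is the top digit plus a remainder in `[0, 1)`, so an interval test
identifies the digit. Digits are nonzero, hence only the empty stack has value 0. -/
theorem holds_topTest {v : ι → ℝ} {j : ι} {l : List Γ'} (h : v j = stackVal l) (o : Option Γ') :
    (topTest j o).Holds v ↔ o = l.head? := by
  cases l with
  | nil =>
    cases o with
    | none => simp [topTest, RTest.Holds, RExpr.eval, h, stackVal]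
    | some a =>
      have := digit_bounds a
      simp only [topTest, RTest.Holds, RExpr.eval, h, stackVal, List.head?_nil, reduceCtorEq,
        iff_false]
      push_cast
      rintro ⟨h1, -⟩
      apply h1
      linarith
  | cons c l =>
    have hl := stackVal_bounds l
    have hc := digit_bounds c
    cases o with
    | none =>
      simp only [topTest, RTest.Holds, RExpr.eval, h, stackVal, List.head?_cons, reduceCtorEq,
        iff_false]
      push_cast
      intro h1
      linarith
    | some a =>
      simp only [topTest, RTest.Holds, RExpr.eval, h, stackVal, List.head?_cons, Option.some_inj]
      push_cast
      constructor
      · rintro ⟨h1, h2⟩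
        -- The digits `a` and `c` differ by less than 1 as reals, hence are equal as integers.
        have h3 : (digit a : ℝ) < (digit c + 1 : ℕ) := by push_cast; linarith
        have h4 : (digit c : ℝ) < (digit a + 1 : ℕ) := by push_cast; linarith
        rw [Nat.cast_lt] at h3 h4
        exact digit_injective (by omega)
      · rintro rfl
        constructor <;> linarith

theorem eval_popExpr {v : ι → ℝ} {j : ι} {l : List Γ'} (h : v j = stackVal l) :
    (popExpr j l.head?).eval v = stackVal l.tail := by
  cases l with
  | nil => simp [popExpr, RExpr.eval, h]
  | cons c l =>
    simp only [popExpr, RExpr.eval, h, stackVal, List.head?_cons, List.tail_cons]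
    push_cast
    ring

theorem eval_pushExpr {v : ι → ℝ} {j : ι} {l : List Γ'} (h : v j = stackVal l) (a : Γ') :
    (pushExpr j a).eval v = stackVal (a :: l) := by
  simp only [pushExpr, RExpr.eval, h, stackVal]
  push_cast
  ring

/-! ### Binary numerals on the stack, least significant digit on top -/

theorem trNat_two_mul_add_one (m : ℕ) : trNat (2 * m + 1) = Γ'.bit1 :: trNat m := by
  have h : ((2 * m + 1 : ℕ) : Num) = Num.bit1 (m : Num) := by
    rw [← Num.of_to_nat (Num.bit1 _), Num.cast_bit1, Num.to_of_nat, two_mul]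
  rw [trNat, trNat, h]
  cases (m : Num) <;> rfl

/-- Zero is the empty numeral, so pushing `bit0` doubles only nonzero numbers. -/
theorem trNat_two_mul {m : ℕ} (hm : m ≠ 0) : trNat (2 * m) = Γ'.bit0 :: trNat m := by
  have h : ((2 * m : ℕ) : Num) = Num.bit0 (m : Num) := by
    rw [← Num.of_to_nat (Num.bit0 _), Num.cast_bit0, Num.to_of_nat, two_mul]
  have h0 : (m : Num) ≠ 0 := by
    intro h1
    apply hm
    rw [← Num.to_of_nat m, h1]; rfl
  rw [trNat, trNat, h]
  cases h1 : (m : Num) with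
  | zero => exact absurd h1 h0
  | pos p => rfl

/-! ### Stack machines as register systems -/

/-- The registers: one per stack, the program counter and two registers for the input. -/
abbrev MReg := K' ⊕ Fin 3

instance : Fintype K' := ⟨{.main, .rev, .aux, .stack}, by rintro ⟨⟩ <;> simp⟩

/-- The register of a stack. -/
abbrev stReg (k : K') : MReg := .inl k
/-- The program counter. -/
abbrev pcReg : MReg := .inr 0
/-- The register of `2⁻ᵐ`, where `m` is the number that has been written to the main stack. -/
abbrev outReg : MReg := .inr 1
/-- The register of `2⁻ⁿ`, where `n` is the input. -/
abbrev inReg : MReg := .inr 2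

variable {Q : Type} (F : Finset Q)

open scoped Classical in
/-- A numbering of the states: `none` is the state in which the input is written to the main
stack, `some none` is the halting state. -/
noncomputable def stateIx : Option (Option Q) → ℕ
  | none => 0
  | some none => 1
  -- The value outside `F` collides with that of the loading state; this is harmless because runs
  -- from `q₀` stay in `F`.
  | some (some q) => if h : q ∈ F then F.equivFin ⟨q, h⟩ + 2 else 0

/-- The value of the program counter. -/
noncomputable def pcVal (q : Option (Option Q)) : ℚ := 1 / (stateIx F q + 1)

theorem pcVal_bounds (q : Option (Option Q)) : (pcVal F q : ℝ) ≤ 1 := by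
  rw [pcVal]
  push_cast
  rw [div_le_one (by positivity)]
  simp

theorem pcVal_eq_iff {q q' : Option (Option Q)} :
    (pcVal F q : ℝ) = pcVal F q' ↔ stateIx F q = stateIx F q' := by
  simp [pcVal]

variable {F}

theorem stateIx_eq_iff {q q' : Q} (hq : q ∈ F) (hq' : q' ∈ F) :
    stateIx F (some (some q)) = stateIx F (some (some q')) ↔ q = q' := by
  simp [stateIx, hq, hq', Fin.val_inj]

variable (F)

/-- The condition of an instruction on the stacks, if it finds `o`. -/
def StackInstr.test (o : Option Γ') : StackInstr (Option Q) → RTest MReg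
  | .push _ _ _ => .eq (.num 0) (.num 0)
  | .peek k _ => topTest (stReg k) o
  | .pop k _ => topTest (stReg k) o
  | .jump _ => .eq (.num 0) (.num 0)

/-- The new values of the registers after an instruction that finds `o`. -/
noncomputable def StackInstr.assign (o : Option Γ') : StackInstr (Option Q) → MReg → RExpr MReg
  | .push k a q => Function.update
      (Function.update .reg pcReg (.num (pcVal F (some q)))) (stReg k) (pushExpr (stReg k) a)
  | .peek _ q => Function.update .reg pcReg (.num (pcVal F (some (q o))))
  | .pop k q => Function.update
      (Function.update .reg pcReg (.num (pcVal F (some (q o))))) (stReg k) (popExpr (stReg k) o)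
  | .jump q => Function.update .reg pcReg (.num (pcVal F (some q)))

/-- The rules for writing the input to the main stack: two for the binary digits and one for
starting the machine. -/
noncomputable def loadGuard : Fin 3 → RTest MReg :=
  -- The middle test says `2⁻ᵐ < 1`, that is `m ≠ 0`, and so excludes leading zeros.
  ![.eq (.num 0) (.num 0), .lt (.reg outReg) (.num 1), .eq (.reg outReg) (.reg inReg)]

/-- The new values of the registers while the input is written to the main stack. -/
noncomputable def loadAssign (q₀ : Q) : Fin 3 → MReg → RExpr MReg :=
  -- The exponent is updated by `2⁻⁽²ᵐ⁺¹⁾ = (2⁻ᵐ)² / 2` here, and by `2⁻²ᵐ = (2⁻ᵐ)²` in the next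
  -- rule.
  ![Function.update (Function.update .reg (stReg .main) (pushExpr (stReg .main) .bit1)) outReg
      (.mul (.num (1 / 2)) (.mul (.reg outReg) (.reg outReg))),
    Function.update (Function.update .reg (stReg .main) (pushExpr (stReg .main) .bit0)) outReg
      (.mul (.reg outReg) (.reg outReg)),
    Function.update .reg pcReg (.num (pcVal F (some (some q₀))))]

/-- The register system of a stack machine. -/
noncomputable def stackSystem (prog : Q → StackInstr (Option Q)) (q₀ : Q) :
    RegSystem MReg (Fin 3 ⊕ F × Option Γ') where
  guard
    | .inl i => .and (.eq (.reg pcReg) (.num (pcVal F none))) (loadGuard i)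
    | .inr (q, o) => .and (.eq (.reg pcReg) (.num (pcVal F (some (some q))))) ((prog q).test o)
  update
    | .inl i => loadAssign F q₀ i
    | .inr (q, o) => (prog q).assign F o

/-- The initial values of the registers for the input `n`. -/
def initVal (n : ℕ) : MReg → ℚ
  | .inl .main => digit .cons / 5
  | .inl _ => 0
  | .inr 0 => 1
  | .inr 1 => 1
  | .inr 2 => 1 / 2 ^ n

/-- The values of the registers. -/
noncomputable def regVec (p : Option (Option Q)) (m n : ℕ) (T : K' → List Γ') : MReg → ℝ
  | .inl k => stackVal (T k)
  | .inr 0 => pcVal F p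
  | .inr 1 => 1 / 2 ^ m
  | .inr 2 => 1 / 2 ^ n

theorem regVec_stReg (p : Option (Option Q)) (m n : ℕ) (T : K' → List Γ') (k : K') :
    regVec F p m n T (stReg k) = stackVal (T k) := rfl

theorem regVec_le (p : Option (Option Q)) (m n : ℕ) (T : K' → List Γ') (j : MReg) :
    regVec F p m n T j ≤ 1 := by
  have h : ∀ m : ℕ, (1 : ℝ) / 2 ^ m ≤ 1 := fun m => by
    rw [div_le_one (by positivity)]
    exact one_le_pow₀ (by norm_num)
  rcases j with k | j
  · exact (stackVal_bounds _).2.le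
  · fin_cases j
    exacts [pcVal_bounds F p, h m, h n]

/-- Loading begins at `m = 0`, where the main stack holds only the terminator `cons` and `2⁻ᵐ = 1`.
-/
theorem initVal_eq (n : ℕ) :
    (fun j => (initVal n j : ℝ)) = regVec F none 0 n (inputStacks 0) := by
  funext j
  rcases j with (_ | _ | _ | _) | j
  · simp [initVal, regVec, inputStacks, stackVal]
  · simp [initVal, regVec, inputStacks, stackVal]
  · simp [initVal, regVec, inputStacks, stackVal]
  · simp [initVal, regVec, inputStacks, stackVal]
  · fin_cases j <;> simp [initVal, regVec, pcVal, stateIx]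

theorem holds_test {v : MReg → ℝ} {T : K' → List Γ'} (hv : ∀ k, v (stReg k) = stackVal (T k))
    (i : StackInstr (Option Q)) : ∃ o, (i.test o).Holds v := by
  cases i with
  | push k a q => exact ⟨none, rfl⟩
  | peek k q => exact ⟨_, (holds_topTest (hv k) _).2 rfl⟩
  | pop k q => exact ⟨_, (holds_topTest (hv k) _).2 rfl⟩
  | jump q => exact ⟨none, rfl⟩

theorem eval_assign {p : Option (Option Q)} {m n : ℕ} {T : K' → List Γ'}
    {i : StackInstr (Option Q)} {o : Option Γ'} (ho : (i.test o).Holds (regVec F p m n T)) :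
    (fun j => (i.assign F o j).eval (regVec F p m n T)) =
      regVec F (some (i.exec T).1) m n (i.exec T).2 := by
  funext j
  cases i with
  | push k a q =>
    rcases j with k' | j
    · by_cases h : k' = k
      · subst h
        simpa [StackInstr.assign, StackInstr.exec, regVec] using eval_pushExpr (regVec_stReg F p m n T k') a
      · simp [StackInstr.assign, StackInstr.exec, regVec, h, RExpr.eval]
    · fin_cases j <;> simp [StackInstr.assign, StackInstr.exec, regVec, RExpr.eval]
  | peek k q =>
    obtain rfl := (holds_topTest (regVec_stReg F p m n T k) o).1 ho
    rcases j with k' | j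
    · simp [StackInstr.assign, StackInstr.exec, regVec, RExpr.eval]
    · fin_cases j <;> simp [StackInstr.assign, StackInstr.exec, regVec, RExpr.eval]
  | pop k q =>
    obtain rfl := (holds_topTest (regVec_stReg F p m n T k) o).1 ho
    rcases j with k' | j
    · by_cases h : k' = k
      · subst h
        simpa [StackInstr.assign, StackInstr.exec, regVec] using eval_popExpr (regVec_stReg F p m n T k')
      · simp [StackInstr.assign, StackInstr.exec, regVec, h, RExpr.eval]
    · fin_cases j <;> simp [StackInstr.assign, StackInstr.exec, regVec, RExpr.eval]
  | jump q =>
    rcases j with k' | j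
    · simp [StackInstr.assign, StackInstr.exec, regVec, RExpr.eval]
    · fin_cases j <;> simp [StackInstr.assign, StackInstr.exec, regVec, RExpr.eval]

theorem eval_loadAssign_bit1 (q₀ : Q) (m n : ℕ) :
    (fun j => (loadAssign F q₀ 0 j).eval (regVec F none m n (inputStacks m))) =
      regVec F none (2 * m + 1) n (inputStacks (2 * m + 1)) := by
  funext j
  rcases j with (_ | _ | _ | _) | j
  · simpa [loadAssign, regVec, inputStacks, trNat_two_mul_add_one] using eval_pushExpr (regVec_stReg F none m n (inputStacks m) .main) _
  · simp [loadAssign, regVec, inputStacks, RExpr.eval]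
  · simp [loadAssign, regVec, inputStacks, RExpr.eval]
  · simp [loadAssign, regVec, inputStacks, RExpr.eval]
  · fin_cases j <;> simp [loadAssign, regVec, RExpr.eval]
    ring

theorem eval_loadAssign_bit0 (q₀ : Q) {m : ℕ} (hm : m ≠ 0) (n : ℕ) :
    (fun j => (loadAssign F q₀ 1 j).eval (regVec F none m n (inputStacks m))) =
      regVec F none (2 * m) n (inputStacks (2 * m)) := by
  funext j
  rcases j with (_ | _ | _ | _) | j
  · simpa [loadAssign, regVec, inputStacks, trNat_two_mul hm] using eval_pushExpr (regVec_stReg F none m n (inputStacks m) .main) _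
  · simp [loadAssign, regVec, inputStacks, RExpr.eval]
  · simp [loadAssign, regVec, inputStacks, RExpr.eval]
  · simp [loadAssign, regVec, inputStacks, RExpr.eval]
  · fin_cases j <;> simp [loadAssign, regVec, RExpr.eval]
    ring

theorem eval_loadAssign_start (q₀ : Q) (m n : ℕ) (T : K' → List Γ') :
    (fun j => (loadAssign F q₀ 2 j).eval (regVec F none m n T)) =
      regVec F (some (some q₀)) m n T := by
  funext j
  rcases j with k | j
  · simp [loadAssign, regVec, RExpr.eval]
  · fin_cases j <;> simp [loadAssign, regVec, RExpr.eval]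

/-! ### Correctness of the simulation -/

variable {F}

/-- The registers hold a configuration that occurs for the input `n`. -/
def GoodRegs (F : Finset Q) (prog : Q → StackInstr (Option Q)) (q₀ : Q) (n : ℕ)
    (v : MReg → ℝ) : Prop :=
  (∃ m, v = regVec F none m n (inputStacks m)) ∨
  ∃ q T, StateTransition.Reaches (stackStep prog) (some q₀, inputStacks n) (q, T) ∧
    (∀ q' ∈ q, q' ∈ F) ∧ v = regVec F (some q) n n T

theorem RegSystem.next_of_holds {ι ρ : Type} {P : RegSystem ι ρ} {i : ρ} {v : ι → ℝ}
    (h : (P.guard i).Holds v) : P.next i v = fun j => (P.update i j).eval v :=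
  funext fun _ => if_pos h

section

variable {prog : Q → StackInstr (Option Q)} {q₀ : Q}

/-- Loading may guess any `m`, but the starting rule compares `2⁻ᵐ` with `2⁻ⁿ`, so the machine only
ever runs on `n`. Afterwards the program counter and the tests leave just the rules that carry out
the machine's own next step. -/
theorem GoodRegs.step (hq₀ : q₀ ∈ F) (hF : ∀ q ∈ F, ∀ T, ∀ q' ∈ ((prog q).exec T).1, q' ∈ F)
    {n : ℕ} {v w : MReg → ℝ} (hv : GoodRegs F prog q₀ n v)
    (hw : (stackSystem F prog q₀).Step v w) : GoodRegs F prog q₀ n w := by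
  obtain ⟨i, hi, rfl⟩ := hw
  rw [RegSystem.next_of_holds hi]
  rcases i with i | ⟨⟨q, hq⟩, o⟩
  · obtain ⟨h1, h2⟩ := hi
    rcases hv with ⟨m, rfl⟩ | ⟨q', T, -, h3, rfl⟩
    · fin_cases i
      · exact Or.inl ⟨_, eval_loadAssign_bit1 F q₀ m n⟩
      · refine Or.inl ⟨_, eval_loadAssign_bit0 F q₀ ?_ n⟩
        rintro rfl
        simp [loadGuard, RTest.Holds, RExpr.eval, regVec] at h2
      · have h3 : m = n := by
          have h4 : (1 : ℝ) / 2 ^ m = 1 / 2 ^ n := h2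
          rw [one_div, one_div, inv_inj] at h4
          exact pow_right_injective₀ (by norm_num) (by norm_num) h4
        subst h3
        exact Or.inr ⟨some q₀, _, Relation.ReflTransGen.refl, by simpa using hq₀,
          eval_loadAssign_start F q₀ m m _⟩
    · exfalso
      -- Loading rules need index 0, whereas the halting state and the states in `F` have positive
      -- indices.
      have h4 := (pcVal_eq_iff F).1 h1
      rcases q' with _ | q'
      · simp [stateIx] at h4
      · simp [stateIx, h3 q' rfl] at h4
  · obtain ⟨h1, h2⟩ := hi
    rcases hv with ⟨m, rfl⟩ | ⟨q', T, hT, h3, rfl⟩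
    · have h4 := (pcVal_eq_iff F).1 h1
      simp [stateIx, hq] at h4
    · have h4 := (pcVal_eq_iff F).1 h1
      rcases q' with _ | q'
      · simp [stateIx, hq] at h4
      · obtain rfl := (stateIx_eq_iff (h3 q' rfl) hq).1 h4
        exact Or.inr ⟨_, _, hT.tail rfl, hF q' hq T, eval_assign F h2⟩

theorem goodRegs_of_reaches (hq₀ : q₀ ∈ F)
    (hF : ∀ q ∈ F, ∀ T, ∀ q' ∈ ((prog q).exec T).1, q' ∈ F) {n : ℕ} {v : MReg → ℝ}
    (hv : (stackSystem F prog q₀).Reaches (fun j => (initVal n j : ℝ)) v) :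
    GoodRegs F prog q₀ n v := by
  induction hv with
  | refl => exact Or.inl ⟨0, initVal_eq F n⟩
  | tail _ h ih => exact ih.step hq₀ hF h

theorem GoodRegs.le_one {n : ℕ} {v : MReg → ℝ} (hv : GoodRegs F prog q₀ n v) (j : MReg) :
    v j ≤ 1 := by
  rcases hv with ⟨m, rfl⟩ | ⟨q', T, -, -, rfl⟩ <;> exact regVec_le F _ _ _ _ j

/-- Every `m` can be guessed, by recursion on its binary expansion from the most significant digit.
-/
theorem reaches_load (n m : ℕ) :
    (stackSystem F prog q₀).Reaches (fun j => (initVal n j : ℝ))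
      (regVec F none m n (inputStacks m)) := by
  induction m using Nat.strong_induction_on with
  | _ m ih =>
    rcases Nat.even_or_odd' m with ⟨l, rfl | rfl⟩
    · rcases Nat.eq_zero_or_pos l with rfl | hl
      · rw [initVal_eq F]
        exact Relation.ReflTransGen.refl
      · have hg : ((stackSystem F prog q₀).guard (.inl 1)).Holds
            (regVec F none l n (inputStacks l)) := by
          refine ⟨rfl, ?_⟩
          change (1 : ℝ) / 2 ^ l < ((1 : ℚ) : ℝ)
          rw [div_lt_iff₀ (by positivity), Rat.cast_one, one_mul]
          exact one_lt_pow₀ (by norm_num) hl.ne'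
        refine (ih l (by omega)).tail ⟨.inl 1, hg, ?_⟩
        rw [RegSystem.next_of_holds hg]
        exact (eval_loadAssign_bit0 F q₀ hl.ne' n).symm
    · have hg : ((stackSystem F prog q₀).guard (.inl 0)).Holds
          (regVec F none l n (inputStacks l)) := ⟨rfl, rfl⟩
      refine (ih l (by omega)).tail ⟨.inl 0, hg, ?_⟩
      rw [RegSystem.next_of_holds hg]
      exact (eval_loadAssign_bit1 F q₀ l n).symm

theorem reaches_run (hq₀ : q₀ ∈ F)
    (hF : ∀ q ∈ F, ∀ T, ∀ q' ∈ ((prog q).exec T).1, q' ∈ F) {n : ℕ}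
    {c : Option Q × (K' → List Γ')}
    (hc : StateTransition.Reaches (stackStep prog) (some q₀, inputStacks n) c) :
    (stackSystem F prog q₀).Reaches (fun j => (initVal n j : ℝ)) (regVec F (some c.1) n n c.2) ∧
      ∀ q ∈ c.1, q ∈ F := by
  induction hc with
  | refl =>
    refine ⟨?_, by simpa using hq₀⟩
    have hg : ((stackSystem F prog q₀).guard (.inl 2)).Holds
      (regVec F none n n (inputStacks n)) := ⟨rfl, rfl⟩
    refine (reaches_load n n).tail ⟨.inl 2, hg, ?_⟩
    rw [RegSystem.next_of_holds hg]
    exact (eval_loadAssign_start F q₀ n n _).symm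
  | @tail c d _ h ih =>
    obtain ⟨_ | q, T⟩ := c
    · cases h
    · obtain rfl := Option.some.inj h
      have hq : q ∈ F := ih.2 q rfl
      refine ⟨?_, hF q hq T⟩
      -- The rules for `q` branch over all possible observations `o`; one of them passes its test.
      obtain ⟨o, ho⟩ := holds_test (regVec_stReg F (some (some q)) n n T) (prog q)
      have hg : ((stackSystem F prog q₀).guard (.inr (⟨q, hq⟩, o))).Holds
        (regVec F (some (some q)) n n T) := ⟨rfl, ho⟩
      refine ih.1.tail ⟨.inr (⟨q, hq⟩, o), hg, ?_⟩
      rw [RegSystem.next_of_holds hg]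
      exact (eval_assign F ho).symm

theorem reaches_halt_iff (hq₀ : q₀ ∈ F)
    (hF : ∀ q ∈ F, ∀ T, ∀ q' ∈ ((prog q).exec T).1, q' ∈ F) (n : ℕ) :
    (∃ v, (stackSystem F prog q₀).Reaches (fun j => (initVal n j : ℝ)) v ∧
      (RTest.eq (.reg pcReg) (.num (pcVal F (some none)))).Holds v) ↔
    (eval (stackStep prog) (some q₀, inputStacks n)).Dom := by
  rw [eval_stackStep_dom]
  constructor
  · rintro ⟨v, hv, hg⟩
    rcases goodRegs_of_reaches hq₀ hF hv with ⟨m, rfl⟩ | ⟨q, T, hT, h3, rfl⟩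
    · have h4 := (pcVal_eq_iff F).1 hg
      simp [stateIx] at h4
    · have h4 := (pcVal_eq_iff F).1 hg
      rcases q with _ | q
      · exact ⟨T, hT⟩
      · simp [stateIx, h3 q rfl] at h4
  · rintro ⟨T, hT⟩
    exact ⟨_, (reaches_run hq₀ hF hT).1, rfl⟩

end

/-! ### Computability of the reduction -/

theorem primrec_two_pow : Primrec fun n : ℕ => 2 ^ n :=
  (Primrec₂.unpaired'.1 Nat.Primrec.pow).comp (Primrec.const 2) Primrec.id

/-- Only the input register varies with `n`; its value `2⁻ⁿ` is coded through numerator 1 and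
denominator `2ⁿ`. -/
theorem primrec_code_initVal (S : Signature) (j : MReg) :
    Primrec fun n => (TimeTerm.num (initVal n j) : TimeTerm S 0 0).code := by
  rcases j with (_ | _ | _ | _) | j
  · exact Primrec.const (TimeTerm.num (digit .cons / 5) : TimeTerm S 0 0).code
  iterate 3 exact Primrec.const (TimeTerm.num 0 : TimeTerm S 0 0).code
  fin_cases j
  iterate 2 exact Primrec.const (TimeTerm.num 1 : TimeTerm S 0 0).code
  · have h : ∀ n : ℕ, initVal n (.inr 2) = ((2 ^ n : ℕ) : ℚ)⁻¹ := fun n => by simp [initVal]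
    have h1 : ∀ n : ℕ, (initVal n (.inr 2)).num = 1 := fun n => by
      rw [h, Rat.inv_natCast_num_of_pos (by positivity)]
    have h2 : ∀ n : ℕ, (initVal n (.inr 2)).den = 2 ^ n := fun n => by
      rw [h, Rat.inv_natCast_den_of_pos (by positivity)]
    refine (Primrec₂.natPair.comp (Primrec.const 1)
      (Primrec₂.natPair.comp (Primrec.const (Encodable.encode (1 : ℤ))) primrec_two_pow)).of_eq
        fun n => ?_
    change _ = Nat.pair 1 (Nat.pair (Encodable.encode (initVal n (.inr 2)).num)
      (initVal n (.inr 2)).den)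
    rw [h1, h2]

/-- The input of the reachability problem for the halting of a stack machine on `n`. -/
noncomputable def haltInput {Q : Type} (F : Finset Q) (prog : Q → StackInstr (Option Q)) (q₀ : Q)
    (n : ℕ) : Input where
  sig := regSig MReg (Fin 3 ⊕ F × Option Γ')
  theory := (stackSystem F prog q₀).bat (initVal n)
  property := (RTest.eq (.reg pcReg) (.num (pcVal F (some none)))).toFormula _

theorem primrec_code_haltInput {Q : Type} (F : Finset Q) (prog : Q → StackInstr (Option Q))
    (q₀ : Q) : Primrec fun n => (haltInput F prog q₀ n).code := by
  have hinit : Primrec fun n => ((stackSystem F prog q₀).bat (initVal n)).init.map Formula.code := by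
    simp only [RegSystem.bat, List.map_ofFn]
    exact Primrec.list_ofFn fun i => Primrec₂.natPair.comp (Primrec.const 4)
      (Primrec₂.natPair.comp (Primrec.const (TimeTerm.code (regTerm _ (regIx _ _ i))))
        (primrec_code_initVal _ _))
  -- All axioms other than the initial ones are independent of `n`, so their codes can be taken at
  -- `n = 0` as constants.
  let D := (stackSystem F prog q₀).bat (initVal 0)
  exact Primrec₂.natPair.comp (Primrec.const (haltInput F prog q₀ 0).sig.code)
    (Primrec₂.natPair.comp
      (Primrec.encode.comp (Primrec.list_cons.comp hinit (Primrec.const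
        [List.ofFn fun i => (D.poss i).code, List.ofFn fun i => (D.ssaRel i).code,
          List.ofFn fun i => (D.ssaObj i).code, List.ofFn fun i => (D.ssaTime i).code])))
      (Primrec.const (haltInput F prog q₀ 0).property.code))

/-- Reachability is undecidable under any condition on the sort time that admits models for all
register systems whose registers stay below `1`. -/
theorem not_decidableReachability (K : ∀ S : Signature, Interpretation S → Prop)
    (hK : ∀ (ι ρ : Type) [Fintype ι] [Fintype ρ] [Nonempty ρ] (P : RegSystem ι ρ) (q : ι → ℚ),
      (∀ v, P.Reaches (fun j => (q j : ℝ)) v → ∀ j, v j ≤ 1) → (P.bat q).Consistent (K _)) :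
    ¬ DecidableReachability K := by
  rintro ⟨f, hf, hdec⟩
  -- A single machine suffices: it runs the program with code `n` on input 0, so its halting set is
  -- undecidable.
  have hg : Partrec fun n : ℕ => (Denumerable.ofNat Nat.Partrec.Code n).eval 0 :=
    Nat.Partrec.Code.eval_part.comp (Computable.ofNat _) (Computable.const 0)
  obtain ⟨Q, prog, F, q₀, hq₀, hF, hdom⟩ := exists_stackMachine hg
  have key : ∀ n, f (haltInput F prog q₀ n).code = true ↔
      ((Denumerable.ofNat Nat.Partrec.Code n).eval 0).Dom := by
    intro n
    have hc : ((stackSystem F prog q₀).bat (initVal n)).Consistent (K _) :=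
      hK _ _ _ _ fun v hv => (goodRegs_of_reaches hq₀ hF hv).le_one
    rw [hdec (haltInput F prog q₀ n) (by simp [Input.RealValued, haltInput, regSig])
      (RegSystem.completeInformation _ _) hc,
      ← hdom, ← reaches_halt_iff hq₀ hF]
    exact RegSystem.entailsReachable_iff hc _
  refine ComputablePred.halting_problem 0 (ComputablePred.computable_iff.2
    ⟨fun c => f (haltInput F prog q₀ (Encodable.encode c)).code,
      hf.comp ((primrec_code_haltInput F prog q₀).comp Primrec.encode).to_comp, ?_⟩)
  funext c
  exact propext (by rw [key, Denumerable.ofNat_encode])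

end SitCalc

theorem mainTheorem4 (b : ℝ) (hb : 2 ≤ b) :
    ¬ SitCalc.DecidableReachability (fun _ M => M.FluentsBounded b) ∧
    ¬ SitCalc.DecidableReachability (fun _ M => M.SortBounded b) := by
  have hb' : (1 : ℝ) ≤ b := by linarith
  exact ⟨SitCalc.not_decidableReachability _ fun _ _ _ _ _ _ _ h =>
      SitCalc.RegSystem.consistent_fluentsBounded fun v hv j => (h v hv j).trans hb',
    SitCalc.not_decidableReachability _ fun _ _ _ _ _ _ _ h =>
      SitCalc.RegSystem.consistent_sortBounded fun v hv j => (h v hv j).trans hb'⟩
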